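/- Let $\mathbb{F}_q$ be a finite field with $q$ elements and of characteristic $p$, and let $n\ge 0$ be an integer. Let $K$ and $R$ be powers of $p$ (with nonnegative integer exponents) such that $1<KR\le q^n$, and let $d$ be a positive integer. If $$\sum_{j=1}^{d-1}\binom{n}{j}(q^2-1)^j\,\bigl(q^nKR-q^nR/K\bigr)<(p-1)(q^{2n}-1),$$ then there exists an $((n,K,R,\ge d))_q$ subsystem code, in the following sense. The state space of $n$ qudits is $\mathcal H=(\mathbb{C}^q)^{\otimes n}=\mathbb{C}^{q^n}$ with orthonormal basis $|x\rangle$, $x\in\mathbb{F}_q^n$. On $\mathbb{C}^q$ let $X_a|x\rangle=|x+a\rangle$ and $Z_b|x\rangle=\omega^{\operatorname{tr}_{q/p}(bx)}|x\rangle$ for $a,b\in\mathbb{F}_q$, where $\omega=e^{2\pi i/p}$. The errors are the operators $\omega^c e_1\otimes\cdots\otimes e_n$ with $c\in\mathbb{F}_p$ and $e_i=X_{a_i}Z_{b_i}$; the weight of such an error is the number of $i$ with $(a_i,b_i)\ne(0,0)$. A subsystem code is a subspace $Q\subseteq\mathcal H$ with a tensor product decomposition $Q=A\otimes B$ as Hilbert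 spaces. An error $E$ is detectable on the subsystem $A$ if $PEP=\mathrm{id}_A\otimes T$ on $Q$ for some linear operator $T$ on $B$, where $P$ is the orthogonal projection onto $Q$. An $((n,K,R,\ge d))_q$ subsystem code is a subsystem code $Q=A\otimes B\subseteq\mathcal H$ with $\dim A=K$ and $\dim B=R$ for which every error of weight less than $d$ is detectable on $A$. -/

import Mathlib

open scoped TensorProduct

noncomputable section

/-- The state space of `n` qudits, `ℂ^q ⊗ ⋯ ⊗ ℂ^q = ℂ^(q^n)` with `q = |F|`: the Hilbert space with
orthonormal basis `|x⟩`, `x ∈ F^n`. -/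
abbrev QuditSpace (F : Type*) [Fintype F] (n : ℕ) : Type _ :=
  EuclideanSpace ℂ (Fin n → F)

/-- The single-qudit shift operator `X_a |y⟩ = |y + a⟩`, as a matrix. -/
def shiftX {F : Type*} [Field F] [DecidableEq F] (a : F) : Matrix F F ℂ :=
  Matrix.of fun x y => if x = y + a then 1 else 0

/-- The single-qudit phase operator `Z_b |x⟩ = ω^(tr(b x)) |x⟩`, with `ω = exp(2πi/p)` and `tr` the
trace from `F` to its prime field, as a matrix. -/
def phaseZ (p : ℕ) [Fact p.Prime] {F : Type*} [Field F] [DecidableEq F] [Algebra (ZMod p) F]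
    (b : F) : Matrix F F ℂ :=
  Matrix.diagonal fun x => ZMod.stdAddChar (Algebra.trace (ZMod p) F (b * x))

/-- The tensor product `M₁ ⊗ ⋯ ⊗ Mₙ` of single-qudit operators, as a matrix in the basis `|x⟩`. -/
def tensorOp {F : Type*} {n : ℕ} (M : Fin n → Matrix F F ℂ) :
    Matrix (Fin n → F) (Fin n → F) ℂ :=
  Matrix.of fun x y => ∏ i, M i (x i) (y i)

/-- An element `ω^c e₁ ⊗ ⋯ ⊗ eₙ` of the error group on `n` qudits, where `c ∈ 𝔽_p` and
`eᵢ = X_(aᵢ) Z_(bᵢ)`. -/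
structure QuditError (p : ℕ) (F : Type*) (n : ℕ) where
  /-- the exponent `c` of the global phase -/
  c : ZMod p
  /-- the shift parts `aᵢ` -/
  a : Fin n → F
  /-- the phase parts `bᵢ` -/
  b : Fin n → F

/-- The operator `ω^c X_(a₁) Z_(b₁) ⊗ ⋯ ⊗ X_(aₙ) Z_(bₙ)` on the state space. -/
def QuditError.op {p : ℕ} [Fact p.Prime] {F : Type*} [Field F] [Fintype F] [DecidableEq F]
    [Algebra (ZMod p) F] {n : ℕ} (e : QuditError p F n) :
    QuditSpace F n →ₗ[ℂ] QuditSpace F n :=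
  Matrix.toEuclideanLin
    ((ZMod.stdAddChar e.c : ℂ) • tensorOp fun i => shiftX (e.a i) * phaseZ p (e.b i))

/-- The weight of an error: the number of qudits on which it acts nontrivially, that is, of the
`i` for which `X_(aᵢ) Z_(bᵢ)` is not the identity. -/
def QuditError.weight {p : ℕ} {F : Type*} [Field F] [DecidableEq F] {n : ℕ}
    (e : QuditError p F n) : ℕ :=
  (Finset.univ.filter fun i => (e.a i, e.b i) ≠ ((0 : F), (0 : F))).card

/-- A subsystem code in the Hilbert space `H`: a subspace `Q` of `H` together with a tensor product
decomposition `Q = A ⊗ B` of Hilbert spaces; `A` is the subsystem and `B` the co-subsystem. -/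
structure SubsystemCode (H A B : Type*)
    [NormedAddCommGroup H] [InnerProductSpace ℂ H]
    [NormedAddCommGroup A] [InnerProductSpace ℂ A]
    [NormedAddCommGroup B] [InnerProductSpace ℂ B] where
  /-- the code space `Q` -/
  space : Submodule ℂ H
  /-- the decomposition `A ⊗ B = Q` -/
  decomp : (A ⊗[ℂ] B) ≃ₗᵢ[ℂ] space

/-- An error `E` is detectable on the subsystem `A` of `Q = A ⊗ B` if `P E P = id_A ⊗ T` on `Q` for
some operator `T` on the co-subsystem `B`, where `P` is the orthogonal projection onto `Q`. -/
def SubsystemCode.Detects {H A B : Type*}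
    [NormedAddCommGroup H] [InnerProductSpace ℂ H] [FiniteDimensional ℂ H]
    [NormedAddCommGroup A] [InnerProductSpace ℂ A]
    [NormedAddCommGroup B] [InnerProductSpace ℂ B]
    (C : SubsystemCode H A B) (E : H →ₗ[ℂ] H) : Prop :=
  ∃ T : B →ₗ[ℂ] B, ∀ v : A ⊗[ℂ] B,
    C.space.orthogonalProjectionOnto (E (C.decomp v)) = C.decomp (T.lTensor A v)

/-- There is an `((n, K, R, ≥ d))_q` subsystem code, `q = |F|`: a subsystem code `Q = A ⊗ B` in the
state space of `n` qudits with `dim A = K` and `dim B = R` that detects on the subsystem `A` all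
errors of weight less than `d`. -/
def ExistsSubsystemCode (p : ℕ) [Fact p.Prime] (F : Type*) [Field F] [Fintype F] [DecidableEq F]
    [Algebra (ZMod p) F] (n K R d : ℕ) : Prop :=
  ∃ C : SubsystemCode (QuditSpace F n) (EuclideanSpace ℂ (Fin K)) (EuclideanSpace ℂ (Fin R)),
    ∀ e : QuditError p F n, e.weight < d → C.Detects e.op

end

/-! Up to phase, an error is a vector `(a, b)` of `F^n × F^n` over `𝔽_p`, and errors commute up to
the character of the trace-symplectic form. Let `q^n = p^(k+r+c)`, `K = p^k`, `R = p^r`. If errors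
act as shifts and phases on an orthonormal family `|x, y, z⟩` with `x, y, z` in `𝔽_p^k, 𝔽_p^r,
𝔽_p^c`, the span of the `|x, y, 0⟩` can miss only those that fix `z` and act nontrivially on `x`
(`exists_subsystemCode_of_shift_phase`). At most `q^n (KR - R/K)` vectors are bad in this sense
(`ncard_undetectable_add_le`).

Every symplectic choice of coordinates yields such a family (`exists_orthonormal_shift_phase`), so
it suffices to find one in which no nonzero vector of weight below `d` is bad. Isometries are
transitive on nonzero vectors (`exists_isometry_smul_eq`), so averaging over them bounds the mean
number of low-weight vectors that become bad; the hypothesis makes it less than `p - 1`. Bad vectors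
come in punctured lines of `p - 1` elements, so some isometry leaves none
(`exists_isometry_forall_notMem`). -/

/-! ### Weyl commutation relations and their shift-phase form -/

/-- A commuting family of operators on a nonzero finite-dimensional complex space has a common
eigenvector. -/
theorem exists_common_eigenvector {ι H : Type*} [AddCommGroup H] [Module ℂ H]
    [FiniteDimensional ℂ H] [Nontrivial H] (T : ι → H →ₗ[ℂ] H)
    (hT : ∀ i j v, T i (T j v) = T j (T i v)) :
    ∃ v : H, v ≠ 0 ∧ ∃ c : ι → ℂ, ∀ i, T i v = c i • v := by
  suffices key : ∀ m : ℕ, ∀ U : Submodule ℂ H, Module.finrank ℂ U = m → U ≠ ⊥ →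
      (∀ i, ∀ u ∈ U, T i u ∈ U) → ∃ v : H, v ≠ 0 ∧ ∃ c : ι → ℂ, ∀ i, T i v = c i • v from
    key _ ⊤ rfl top_ne_bot fun _ _ _ => Submodule.mem_top
  intro m
  induction m using Nat.strong_induction_on with
  | _ m ih =>
    intro U hm hU hinv
    by_cases hs : ∀ i, ∃ c : ℂ, ∀ u ∈ U, T i u = c • u
    · choose c hc using hs
      obtain ⟨v, hv, hv0⟩ := U.exists_mem_ne_zero_of_ne_bot hU
      exact ⟨v, hv0, c, fun i => hc i v hv⟩
    -- An eigenspace in `U` of a non-scalar `T i` is nonzero and proper, and invariant because the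
    -- family commutes.
    · push Not at hs
      obtain ⟨i, hi⟩ := hs
      have : Nontrivial U := Submodule.nontrivial_iff_ne_bot.mpr hU
      obtain ⟨c, hc⟩ := Module.End.exists_eigenvalue ((T i).restrict (hinv i))
      obtain ⟨w, hw⟩ := hc.exists_hasEigenvector
      have hw1 : T i w = c • (w : H) := congrArg Subtype.val hw.apply_eq_smul
      let U' : Submodule ℂ H := U ⊓ LinearMap.ker (T i - c • LinearMap.id)
      have hmem : ∀ u, u ∈ U' ↔ u ∈ U ∧ T i u = c • u := fun u => by
        simp [U', sub_eq_zero]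
      obtain ⟨u, hu, hu'⟩ := hi c
      refine ih (Module.finrank ℂ U') ?_ U' rfl ?_ ?_
      · rw [← hm]
        refine Submodule.finrank_lt_finrank_of_lt (lt_of_le_of_ne inf_le_left fun h => hu' ?_)
        exact ((hmem u).1 (h ▸ hu)).2
      · refine (Submodule.ne_bot_iff _).2 ⟨w, (hmem _).2 ⟨w.2, hw1⟩, fun h => hw.2 ?_⟩
        exact Subtype.ext h
      · intro j u hu
        rw [hmem] at hu ⊢
        exact ⟨hinv j u hu.1, by rw [hT, hu.2, map_smul]⟩

/-- The alternating pairing of `(x, f)` and `(y, g)` in `X × Dual X` is `f y - g x`. -/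
def sympForm (𝕜 X : Type*) [Field 𝕜] [AddCommGroup X] [Module 𝕜 X] :
    LinearMap.BilinForm 𝕜 (X × Module.Dual 𝕜 X) :=
  LinearMap.mk₂ 𝕜 (fun u v => u.2 v.1 - v.2 u.1)
    (by intros; simp; ring) (by intros; simp; ring) (by intros; simp; ring) (by intros; simp; ring)

@[simp]
theorem sympForm_apply {𝕜 X : Type*} [Field 𝕜] [AddCommGroup X] [Module 𝕜 X]
    (u v : X × Module.Dual 𝕜 X) : sympForm 𝕜 X u v = u.2 v.1 - v.2 u.1 := rfl

/-- A family of isometries satisfying the Weyl commutation relations acts, in a suitable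
orthonormal family, by shifts and phases. -/
theorem exists_orthonormal_shift_phase {p : ℕ} [Fact p.Prime] {X H : Type*} [AddCommGroup X]
    [Module (ZMod p) X] [Module.Finite (ZMod p) X] [NormedAddCommGroup H] [InnerProductSpace ℂ H]
    [FiniteDimensional ℂ H] [Nontrivial H]
    (D : X × Module.Dual (ZMod p) X → H →ₗ[ℂ] H) (hD : ∀ u v, ‖D u v‖ = ‖v‖)
    (σ : X × Module.Dual (ZMod p) X → X × Module.Dual (ZMod p) X → ℂ)
    (hmul : ∀ u v w, D u (D v w) = σ u v • D (u + v) w)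
    (hcomm : ∀ u v w, D u (D v w) =
      (ZMod.stdAddChar (sympForm (ZMod p) X u v) : ℂ) • D v (D u w)) :
    ∃ e : X → H, Orthonormal ℂ e ∧ ∃ c : X × Module.Dual (ZMod p) X → ℂ,
      ∀ x f y, D (x, f) (e y) = (c (x, f) * ZMod.stdAddChar (f y)) • e (x + y) := by
  have hne : ∀ u {w : H}, w ≠ 0 → D u w ≠ 0 := fun u w hw h => hw (by
    rw [← norm_eq_zero, ← hD u, h, norm_zero])
  have hσ : ∀ u v, σ u v ≠ 0 := fun u v h => by
    obtain ⟨w, hw⟩ := exists_ne (0 : H)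
    refine hne u (hne v hw) ?_
    rw [hmul, h, zero_smul]
  obtain ⟨ψ, hψ0, lam, hlam⟩ := exists_common_eigenvector
    (fun f : Module.Dual (ZMod p) X => D (0, f)) (fun f g v => by
      rw [hcomm]; simp)
  -- `φ` serves only to trivialise the cocycle: evaluating `hmul` at `φ` shows that `D (x, 0)`
  -- divided by `mu x` is additive in `x`.
  obtain ⟨φ, hφ0, mu, hmu⟩ := exists_common_eigenvector
    (fun x : X => D (x, 0)) (fun f g v => by
      rw [hcomm]; simp)
  have hmun : ∀ x, ‖mu x‖ = 1 := fun x => by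
    have := congrArg norm (hmu x)
    rw [hD, norm_smul] at this
    have h0 : ‖φ‖ ≠ 0 := norm_ne_zero_iff.mpr hφ0
    field_simp at this
    exact this.symm
  have hmu0 : ∀ x, mu x ≠ 0 := fun x h => by simpa [h] using hmun x
  have hshift : ∀ x y w, D (x, 0) (D (y, 0) w) =
      (mu x * mu y * (mu (x + y))⁻¹) • D (x + y, 0) w := fun x y w => by
    have h1 := hmul (x, 0) (y, 0) φ
    have h2 := hmul (x, 0) (y, 0) w
    simp only [hmu, Prod.mk_add_mk, add_zero, map_smul, smul_smul] at h1 h2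
    rw [h2]
    have h3 := smul_left_injective ℂ hφ0 h1
    congr 1
    have := hmu0 (x + y)
    field_simp
    rw [← h3, mul_comm]
  set N : ℂ := ((‖ψ‖⁻¹ : ℝ) : ℂ) with hN
  have hψn : ‖ψ‖ ≠ 0 := norm_ne_zero_iff.mpr hψ0
  -- The normalised common eigenvector `ψ` of the phases plays the role of `|0⟩`; the corrected
  -- shifts carry it to `|x⟩`.
  let e : X → H := fun x => (N * (mu x)⁻¹) • D (x, 0) ψ
  have heE : ∀ x f y, D (x, f) (e y) =
      ((σ (x, 0) (0, f))⁻¹ * lam f * mu x * ZMod.stdAddChar (f y)) • e (x + y) := fun x f y => by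
    have h1 := hmul (x, 0) (0, f) (e y)
    simp only [Prod.mk_add_mk, add_zero, zero_add] at h1
    rw [← inv_smul_eq_iff₀ (hσ _ _)] at h1
    rw [← h1]
    have h2 := hcomm (0, f) (y, 0) ψ
    simp only [sympForm_apply, LinearMap.zero_apply, sub_zero] at h2
    simp only [e, map_smul, h2, hlam, hshift, smul_smul]
    congr 1
    have := hmu0 y
    field_simp
  have hen : ∀ x, ‖e x‖ = 1 := fun x => by
    simp only [e, norm_smul, norm_mul, norm_inv, hmun, hD, hN]
    simp [hψn]
  refine ⟨e, ⟨hen, fun x y hxy => ?_⟩, fun u => (σ (u.1, 0) (0, u.2))⁻¹ * lam u.2 * mu u.1, heE⟩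
  -- For this `f`, `e x` and `e y` are eigenvectors of the isometry `D (0, f)` with distinct
  -- eigenvalues, hence orthogonal.
  obtain ⟨f, hf⟩ : ∃ f : Module.Dual (ZMod p) X, f (y - x) ≠ 0 := by
    by_contra! hcon
    exact hxy (sub_eq_zero.mp ((Module.forall_dual_apply_eq_zero_iff (ZMod p) _).1 hcon)).symm
  let U : H →ₗᵢ[ℂ] H := ⟨D (0, f), hD _⟩
  have h1 : inner ℂ (D (0, f) (e x)) (D (0, f) (e y)) = inner ℂ (e x) (e y) := U.inner_map_map _ _
  rw [heE, heE, inner_smul_left, inner_smul_right, zero_add, zero_add, ← mul_assoc] at h1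
  by_contra hne0
  have h2 := (mul_eq_right₀ hne0).1 h1
  set a := (σ (0, 0) (0, f))⁻¹ * lam f * mu 0
  have hx1 : ‖(ZMod.stdAddChar (f x) : ℂ)‖ = 1 := AddChar.norm_apply _ _
  have han : ‖a‖ = 1 := by
    have := hD (0, f) (e x)
    rw [heE, norm_smul, hen, hen, norm_mul, hx1, mul_one, mul_one] at this
    exact this
  have hc : (starRingEnd ℂ) a * a = 1 := by
    rw [Complex.conj_mul', han]; simp
  have h3 : (starRingEnd ℂ) (ZMod.stdAddChar (f x) : ℂ) * ZMod.stdAddChar (f y) = 1 := by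
    rw [map_mul] at h2
    linear_combination h2 - (starRingEnd ℂ) (ZMod.stdAddChar (f x) : ℂ) *
      ZMod.stdAddChar (f y) * hc
  have h4 : (starRingEnd ℂ) (ZMod.stdAddChar (f x) : ℂ) * ZMod.stdAddChar (f x) = 1 := by
    rw [Complex.conj_mul', hx1]; simp
  have h5 : (ZMod.stdAddChar (f x) : ℂ) = ZMod.stdAddChar (f y) := by
    have : (starRingEnd ℂ) (ZMod.stdAddChar (f x) : ℂ) ≠ 0 := fun h => by simp [h] at h4
    exact mul_left_cancel₀ this (h4.trans h3.symm)
  exact hf (by rw [map_sub, ZMod.injective_stdAddChar h5, sub_self])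

/-! ### Subsystem codes from orthonormal families -/

/-- An orthonormal family indexed by `Fin K × Fin R` spans a subsystem code, which detects every
operator whose matrix in this family has the form `id ⊗ t`. -/
theorem exists_subsystemCode_of_orthonormal {H : Type*} [NormedAddCommGroup H]
    [InnerProductSpace ℂ H] [FiniteDimensional ℂ H] {K R : ℕ} {e : Fin K × Fin R → H}
    (he : Orthonormal ℂ e) :
    ∃ C : SubsystemCode H (EuclideanSpace ℂ (Fin K)) (EuclideanSpace ℂ (Fin R)),
      ∀ E : H →ₗ[ℂ] H, (∃ t : Fin R → Fin R → ℂ, ∀ i j i' j',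
        inner ℂ (e (i, j)) (E (e (i', j'))) = if i = i' then t j j' else 0) → C.Detects E := by
  let bK := EuclideanSpace.basisFun (Fin K) ℂ
  let bR := EuclideanSpace.basisFun (Fin R) ℂ
  let b := bK.tensorProduct bR
  let J : (EuclideanSpace ℂ (Fin K) ⊗[ℂ] EuclideanSpace ℂ (Fin R)) →ₗᵢ[ℂ] H :=
    (b.toBasis.constr ℂ e).isometryOfOrthonormal (v := b.toBasis) (by simp)
      (by
        convert he using 1
        ext i
        simp)
  have hJ : ∀ i j, J (bK i ⊗ₜ bR j) = e (i, j) := fun i j => by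
    have : b.toBasis (i, j) = bK i ⊗ₜ bR j := by simp [b]
    rw [← this]
    change b.toBasis.constr ℂ e (b.toBasis (i, j)) = _
    simp
  refine ⟨⟨LinearMap.range J.toLinearMap, J.equivRange⟩, fun E ⟨t, ht⟩ => ?_⟩
  let T : EuclideanSpace ℂ (Fin R) →ₗ[ℂ] EuclideanSpace ℂ (Fin R) :=
    bR.toBasis.constr ℂ fun j' => ∑ j, t j j' • bR j
  have hT : ∀ j', T (bR j') = ∑ j, t j j' • bR j := fun j' => by
    have : bR.toBasis j' = bR j' := by simp
    rw [← this]
    simp [T]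
  refine ⟨T, fun v => ?_⟩
  have hlin : ∀ i j i' j', inner ℂ (J (bK i ⊗ₜ bR j)) (E (J (bK i' ⊗ₜ bR j'))) =
      inner ℂ (bK i ⊗ₜ[ℂ] bR j) (T.lTensor _ (bK i' ⊗ₜ bR j')) := fun i j i' j' => by
    rw [hJ, hJ, ht, LinearMap.lTensor_tmul, hT, TensorProduct.inner_tmul, inner_sum]
    simp only [inner_smul_right, bK.inner_eq_ite, bR.inner_eq_ite]
    simp
  have hvec : ∀ i j, inner ℂ (J (bK i ⊗ₜ bR j)) (E (J v)) =
      inner ℂ (bK i ⊗ₜ[ℂ] bR j) (T.lTensor _ v) := fun i j => by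
    let f₁ := (innerₛₗ ℂ (J (bK i ⊗ₜ bR j))) ∘ₗ E ∘ₗ J.toLinearMap
    let f₂ := (innerₛₗ ℂ (bK i ⊗ₜ[ℂ] bR j)) ∘ₗ T.lTensor (EuclideanSpace ℂ (Fin K))
    have : f₁ = f₂ := b.toBasis.ext fun ⟨i', j'⟩ => by
      have : b.toBasis (i', j') = bK i' ⊗ₜ bR j' := by simp [b]
      rw [this]
      exact hlin i j i' j'
    exact LinearMap.congr_fun this v
  change (LinearMap.range J.toLinearMap).orthogonalProjectionOnto (E (J v)) =
    J.equivRange (T.lTensor _ v)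
  -- Both sides lie in the range of `J`, where the projection does not affect inner products, so the
  -- matrix entries in `hvec` decide.
  obtain ⟨w, hw⟩ := J.equivRange.surjective
    ((LinearMap.range J.toLinearMap).orthogonalProjectionOnto (E (J v)))
  rw [← hw]
  congr 1
  refine InnerProductSpace.ext_inner_left_basis b.toBasis fun ⟨i, j⟩ => ?_
  have hb : b.toBasis (i, j) = bK i ⊗ₜ bR j := by simp [b]
  rw [hb, ← hvec, ← J.equivRange.inner_map_map, hw,
    Submodule.inner_orthogonalProjectionOnto_eq_of_mem_left]
  rfl

/-! ### Averaging over the symplectic group -/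

/-- Averaging over a transitive action: some group element moves few points of `T` into `S`. -/
theorem exists_card_filter_smul_mem_lt {G α : Type*} [Group G] [Finite G] [MulAction G α]
    [DecidableEq α] {Ω S T : Finset α} (hS : S ⊆ Ω) (hT : T ⊆ Ω)
    (hΩ : ∀ g : G, ∀ w ∈ Ω, g • w ∈ Ω) (htrans : ∀ w ∈ Ω, ∀ w' ∈ Ω, ∃ g : G, g • w = w')
    {m : ℕ} (h : T.card * S.card < m * Ω.card) :
    ∃ g : G, (T.filter fun w => g • w ∈ S).card < m := by
  classical
  have := Fintype.ofFinite G
  -- Count pairs `(g, w)` with `g • w ∈ S`. Transitivity makes `c` constant on `Ω`, so `T`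
  -- contributes `|T| c` and `Ω` contributes `|Ω| c = |G| |S|`.
  let c : α → ℕ := fun w => (Finset.univ.filter fun g : G => g • w ∈ S).card
  obtain ⟨w₀, hw₀⟩ : Ω.Nonempty := by
    rw [← Finset.card_pos]
    exact Nat.pos_of_mul_pos_left (Nat.zero_lt_of_lt h)
  have hc : ∀ w ∈ Ω, c w = c w₀ := fun w hw => by
    obtain ⟨k, hk⟩ := htrans w₀ hw₀ w hw
    refine Finset.card_bij' (fun g _ => g * k) (fun g _ => g * k⁻¹) ?_ ?_ ?_ ?_
    · intro g hg; simpa [mul_smul, hk] using hg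
    · intro g hg; simpa [mul_smul, ← hk] using hg
    · simp
    · simp
  have hswap : ∀ U : Finset α, ∑ g : G, (U.filter fun w => g • w ∈ S).card = ∑ w ∈ U, c w :=
    fun U => by
      simp only [c, Finset.card_filter]
      exact Finset.sum_comm
  have hfix : ∀ g : G, (Ω.filter fun w => g • w ∈ S).card = S.card := fun g => by
    refine Finset.card_bij' (fun w _ => g • w) (fun w _ => g⁻¹ • w) ?_ ?_ ?_ ?_
    · intro w hw; exact (Finset.mem_filter.1 hw).2
    · intro w hw; exact Finset.mem_filter.2 ⟨hΩ _ _ (hS hw), by simpa using hw⟩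
    · simp
    · simp
  by_contra! hcon
  have h1 : m * Fintype.card G ≤ T.card * c w₀ := by
    calc m * Fintype.card G = ∑ _g : G, m := by simp [mul_comm]
      _ ≤ ∑ g : G, (T.filter fun w => g • w ∈ S).card := Finset.sum_le_sum fun g _ => hcon g
      _ = ∑ w ∈ T, c w := hswap T
      _ = T.card * c w₀ := by
        rw [Finset.sum_congr rfl fun w hw => hc w (hT hw)]; simp
  have h2 : Fintype.card G * S.card = Ω.card * c w₀ := by
    have := hswap Ω
    rw [Finset.sum_congr rfl fun w hw => hc w hw, Finset.sum_congr rfl fun g _ => hfix g] at this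
    simpa using this
  have hG : 0 < Fintype.card G := Fintype.card_pos
  have h3 := Nat.mul_lt_mul_of_pos_left h hG
  have h4 := Nat.mul_le_mul_right Ω.card h1
  nlinarith

/-- The group of linear automorphisms preserving a bilinear form. -/
def bilinIsometryGroup {𝕜 E : Type*} [Field 𝕜] [AddCommGroup E] [Module 𝕜 E]
    (ω : LinearMap.BilinForm 𝕜 E) : Subgroup (E ≃ₗ[𝕜] E) where
  carrier := {g | ∀ u v, ω (g u) (g v) = ω u v}
  mul_mem' {g h} hg hh u v := by
    rw [LinearEquiv.mul_apply, LinearEquiv.mul_apply, hg, hh]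
  one_mem' _ _ := rfl
  inv_mem' {g} hg u v := by
    rw [← hg]
    change ω (g (g.symm u)) (g (g.symm v)) = _
    simp

/-- Symplectic transvections carry `v` to `w` whenever `ω v w ≠ 0`. -/
theorem exists_isometry_of_ne_zero {𝕜 E : Type*} [Field 𝕜] [AddCommGroup E] [Module 𝕜 E]
    {ω : LinearMap.BilinForm 𝕜 E} (hω : ω.IsAlt) {v w : E} (hvw : ω v w ≠ 0) :
    ∃ g : bilinIsometryGroup ω, g • v = w := by
  have hneg : ∀ x y, ω x y = -ω y x := fun x y => (hω.neg_eq y x).symm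
  have hself : ∀ x, ω x x = 0 := hω
  -- The transvection is `x ↦ x + ω(v, w)⁻¹ ω(x, t) t`; since `ω(v, t) = ω(v, w)`, it moves `v` by
  -- exactly `t`.
  set t := w - v with ht
  have hf : ((ω v w)⁻¹ • LinearMap.flip ω t) t = 0 := by simp [hself]
  refine ⟨⟨LinearEquiv.transvection hf, fun x y => ?_⟩, ?_⟩
  · change ω (x + ((ω v w)⁻¹ • LinearMap.flip ω t) x • t)
      (y + ((ω v w)⁻¹ • LinearMap.flip ω t) y • t) = ω x y
    simp only [LinearMap.smul_apply, LinearMap.flip_apply, map_add, map_smul, LinearMap.add_apply,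
      smul_eq_mul, hself, hneg t y]
    ring
  · change v + ((ω v w)⁻¹ • LinearMap.flip ω t) v • t = w
    have : ω v t = ω v w := by simp [ht, hself]
    rw [LinearMap.smul_apply, LinearMap.flip_apply, this, smul_eq_mul, inv_mul_cancel₀ hvw,
      one_smul, ht]
    abel

/-- The isometry group of a nondegenerate alternating form is transitive on nonzero vectors. -/
theorem exists_isometry_smul_eq {𝕜 E : Type*} [Field 𝕜] [AddCommGroup E] [Module 𝕜 E]
    {ω : LinearMap.BilinForm 𝕜 E} (hω : ω.IsAlt) (hnd : ∀ v, v ≠ 0 → ∃ u, ω v u ≠ 0) {v w : E}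
    (hv : v ≠ 0) (hw : w ≠ 0) : ∃ g : bilinIsometryGroup ω, g • v = w := by
  -- Two transvections through `u` will do. Such a `u` exists because a space is not the union of
  -- two proper subspaces.
  obtain ⟨u, hvu, huw⟩ : ∃ u, ω v u ≠ 0 ∧ ω u w ≠ 0 := by
    have hneg : ∀ x, ω x w = -ω w x := fun x => (hω.neg_eq w x).symm
    simp only [hneg, neg_ne_zero]
    obtain ⟨a, ha⟩ := hnd v hv
    obtain ⟨b, hb⟩ := hnd w hw
    by_cases ha' : ω w a = 0
    · by_cases hb' : ω v b = 0
      · exact ⟨a + b, by simpa [hb'] using ha, by simpa [ha'] using hb⟩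
      · exact ⟨b, hb', hb⟩
    · exact ⟨a, ha, ha'⟩
  obtain ⟨g, hg⟩ := exists_isometry_of_ne_zero hω hvu
  obtain ⟨h, hh⟩ := exists_isometry_of_ne_zero hω huw
  exact ⟨h * g, by rw [mul_smul, hg, hh]⟩

theorem sympForm_isAlt (𝕜 X : Type*) [Field 𝕜] [AddCommGroup X] [Module 𝕜 X] :
    (sympForm 𝕜 X).IsAlt := fun u => by simp

theorem exists_sympForm_ne_zero {𝕜 X : Type*} [Field 𝕜] [AddCommGroup X] [Module 𝕜 X]
    {u : X × Module.Dual 𝕜 X} (hu : u ≠ 0) : ∃ v, sympForm 𝕜 X u v ≠ 0 := by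
  by_contra! h
  refine hu (Prod.ext ?_ ?_)
  · refine (Module.forall_dual_apply_eq_zero_iff 𝕜 _).1 fun f => ?_
    simpa using h (0, f)
  · ext x
    simpa using h (x, 0)

/-- If few vectors are prescribed, some symplectic automorphism keeps all of them out of a given
set, provided both sets are closed under nonzero scalars. -/
theorem exists_isometry_forall_notMem {p : ℕ} [Fact p.Prime] {X : Type*} [AddCommGroup X]
    [Module (ZMod p) X] [Fintype (X × Module.Dual (ZMod p) X)]
    {S T : Finset (X × Module.Dual (ZMod p) X)} (hS0 : 0 ∉ S) (hT0 : 0 ∉ T)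
    (hS : ∀ c : ZMod p, c ≠ 0 → ∀ u ∈ S, c • u ∈ S) (hT : ∀ c : ZMod p, c ≠ 0 → ∀ u ∈ T, c • u ∈ T)
    (h : T.card * S.card < (p - 1) * (Fintype.card (X × Module.Dual (ZMod p) X) - 1)) :
    ∃ g : bilinIsometryGroup (sympForm (ZMod p) X), ∀ u ∈ T, g • u ∉ S := by
  classical
  have : Finite ((X × Module.Dual (ZMod p) X) ≃ₗ[ZMod p] (X × Module.Dual (ZMod p) X)) :=
    Finite.of_injective _ DFunLike.coe_injective
  obtain ⟨g, hg⟩ := exists_card_filter_smul_mem_lt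
    (G := bilinIsometryGroup (sympForm (ZMod p) X)) (Ω := {0}ᶜ) (S := S) (T := T) (m := p - 1)
    (fun u hu => by simpa using ne_of_mem_of_not_mem hu hS0)
    (fun u hu => by simpa using ne_of_mem_of_not_mem hu hT0)
    (fun g w hw => by
      simp only [Finset.mem_compl, Finset.mem_singleton] at hw ⊢
      exact fun h0 => hw (g.1.map_eq_zero_iff.1 h0))
    (fun w hw w' hw' => exists_isometry_smul_eq (sympForm_isAlt _ _)
      (fun v hv => exists_sympForm_ne_zero hv) (by simpa using hw) (by simpa using hw'))
    (by rw [Finset.card_compl, Finset.card_singleton]; exact h)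
  refine ⟨g, fun u hu hgu => hg.not_ge ?_⟩
  have hu0 : u ≠ 0 := ne_of_mem_of_not_mem hu hT0
  -- One bad `u` would bring along its `p - 1` nonzero multiples, contradicting `hg`. This is the
  -- source of the factor `p - 1`.
  have hinj : Function.Injective fun c : (ZMod p)ˣ => (c : ZMod p) • u := fun c c' hcc =>
    Units.ext (smul_left_injective (ZMod p) hu0 hcc)
  rw [← ZMod.card_units p, ← Finset.card_univ, ← Finset.card_image_of_injective _ hinj]
  refine Finset.card_le_card fun w hw => ?_
  obtain ⟨c, -, rfl⟩ := Finset.mem_image.1 hw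
  refine Finset.mem_filter.2 ⟨hT c c.ne_zero u hu, ?_⟩
  have : g • ((c : ZMod p) • u) = (c : ZMod p) • g • u :=
    g.1.map_smul _ _
  rw [this]
  exact hS c c.ne_zero _ hgu

/-! ### Counting words of small weight -/

/-- The number of words of Hamming weight between `1` and `d - 1`. -/
theorem card_weight_le {M : Type*} [Fintype M] [DecidableEq M] [Zero M] (n d : ℕ) :
    (Finset.univ.filter fun w : Fin n → M => w ≠ 0 ∧
      (Finset.univ.filter fun i => w i ≠ 0).card < d).card ≤
      ∑ j ∈ Finset.Icc 1 (d - 1), n.choose j * (Fintype.card M - 1) ^ j := by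
  calc _ ≤ ((Finset.Icc 1 (d - 1)).biUnion fun j =>
        (Finset.powersetCard j (Finset.univ : Finset (Fin n))).biUnion fun s =>
          Fintype.piFinset fun i => if i ∈ s then ({0}ᶜ : Finset M) else {0}).card := by
        refine Finset.card_le_card fun w hw => ?_
        obtain ⟨hw0, hwd⟩ := (Finset.mem_filter.1 hw).2
        simp only [Finset.mem_biUnion, Finset.mem_Icc, Finset.mem_powersetCard]
        refine ⟨_, ⟨?_, Nat.le_sub_one_of_lt hwd⟩, _, ⟨Finset.subset_univ _, rfl⟩, ?_⟩
        · refine Finset.card_pos.2 ?_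
          obtain ⟨i, hi⟩ := Function.ne_iff.1 hw0
          exact ⟨i, by simpa using hi⟩
        · rw [Fintype.mem_piFinset]
          intro i
          by_cases hi : w i = 0 <;> simp [hi]
    _ ≤ ∑ j ∈ Finset.Icc 1 (d - 1), n.choose j * (Fintype.card M - 1) ^ j := by
        refine Finset.card_biUnion_le.trans (Finset.sum_le_sum fun j _ => ?_)
        refine Finset.card_biUnion_le.trans (le_of_eq ?_)
        rw [Finset.sum_congr rfl (g := fun _ => (Fintype.card M - 1) ^ j), Finset.sum_const,
          Finset.card_powersetCard, Finset.card_univ, Fintype.card_fin, smul_eq_mul]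
        intro s hs
        rw [Fintype.card_piFinset]
        simp only [apply_ite Finset.card, Finset.card_compl, Finset.card_singleton,
          Finset.prod_ite, Finset.prod_const, one_pow, mul_one]
        rw [← (Finset.mem_powersetCard.1 hs).2]
        congr 2
        ext i; simp

/-! ### Detectable and undetectable shift-phase operators -/

/-- In the presence of a shift-phase family indexed by `A × B × C`, the vectors `|a, b, 0⟩` span a
subsystem code; it detects a shift-phase operator which moves the `C`-coordinate, or acts trivially
on the `A`-coordinate. -/
theorem exists_subsystemCode_of_shift_phase {p : ℕ} [Fact p.Prime] {A B C H : Type*}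
    [AddCommGroup A] [AddCommGroup B] [AddCommGroup C] [Module (ZMod p) A] [Module (ZMod p) B]
    [Module (ZMod p) C] [Fintype A] [Fintype B] [NormedAddCommGroup H] [InnerProductSpace ℂ H]
    [FiniteDimensional ℂ H] {K R : ℕ} (hK : Fintype.card A = K) (hR : Fintype.card B = R)
    {e : A × B × C → H} (he : Orthonormal ℂ e) :
    ∃ Q : SubsystemCode H (EuclideanSpace ℂ (Fin K)) (EuclideanSpace ℂ (Fin R)),
      ∀ (E : H →ₗ[ℂ] H) (x : A × B × C) (f : Module.Dual (ZMod p) (A × B × C)) (c : ℂ),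
        (∀ y, E (e y) = (c * ZMod.stdAddChar (f y)) • e (x + y)) →
        ¬ (x.2.2 = 0 ∧ ¬ (x.1 = 0 ∧ ∀ a, f (a, 0, 0) = 0)) → Q.Detects E := by
  classical
  let eA := (Fintype.equivFinOfCardEq hK).symm
  let eB := (Fintype.equivFinOfCardEq hR).symm
  obtain ⟨Q, hQ⟩ := exists_subsystemCode_of_orthonormal (e := fun ij : Fin K × Fin R =>
    e (eA ij.1, eB ij.2, 0)) (he.comp (fun ij : Fin K × Fin R => (eA ij.1, eB ij.2, (0 : C)))
      fun ij ij' h => by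
        simp only [Prod.mk.injEq, EmbeddingLike.apply_eq_iff_eq, and_true] at h
        exact Prod.ext h.1 h.2)
  have hin := orthonormal_iff_ite.1 he
  refine ⟨Q, fun E x f c hE hx => hQ E ?_⟩
  obtain ⟨xA, xB, xC⟩ := x
  by_cases hC : xC = 0
  · obtain ⟨hA, hf⟩ : xA = 0 ∧ ∀ a, f (a, 0, 0) = 0 := by
      by_contra hcon
      exact hx ⟨hC, hcon⟩
    refine ⟨fun j j' => if eB j = xB + eB j' then c * ZMod.stdAddChar (f (0, eB j', 0)) else 0,
      fun i j i' j' => ?_⟩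
    have hsplit : f (eA i', eB j', 0) = f (0, eB j', 0) := by
      rw [← sub_eq_zero, ← map_sub]
      rw [← hf (eA i'), Prod.mk_sub_mk, Prod.mk_sub_mk, sub_zero, sub_self, sub_zero]
    subst hC hA
    rw [hE, inner_smul_right, hin, hsplit]
    simp only [Prod.mk_add_mk, zero_add, add_zero, Prod.mk.injEq, EmbeddingLike.apply_eq_iff_eq,
      and_true]
    by_cases hi : i = i' <;> by_cases hj : eB j = xB + eB j' <;> simp [hi, hj]
  -- The shift moves the code into an orthogonal subspace, so the compression to the code vanishes.
  · refine ⟨0, fun i j i' j' => ?_⟩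
    rw [hE, inner_smul_right, hin]
    simp [Ne.symm hC]

/-- The vectors that do not give detectable errors. -/
def undetectable (p : ℕ) [Fact p.Prime] (A B C : Type*) [AddCommGroup A] [AddCommGroup B]
    [AddCommGroup C] [Module (ZMod p) A] [Module (ZMod p) B] [Module (ZMod p) C] :
    Set ((A × B × C) × Module.Dual (ZMod p) (A × B × C)) :=
  {u | u.1.2.2 = 0 ∧ ¬ (u.1.1 = 0 ∧ ∀ a, u.2 (a, 0, 0) = 0)}

theorem zero_notMem_undetectable (p : ℕ) [Fact p.Prime] (A B C : Type*) [AddCommGroup A]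
    [AddCommGroup B] [AddCommGroup C] [Module (ZMod p) A] [Module (ZMod p) B]
    [Module (ZMod p) C] : 0 ∉ undetectable p A B C := by
  simp [undetectable]

/-- Needed so that bad vectors fill punctured lines in the averaging argument. -/
theorem smul_mem_undetectable {p : ℕ} [Fact p.Prime] {A B C : Type*} [AddCommGroup A]
    [AddCommGroup B] [AddCommGroup C] [Module (ZMod p) A] [Module (ZMod p) B] [Module (ZMod p) C]
    {c : ZMod p} (hc : c ≠ 0) {u : (A × B × C) × Module.Dual (ZMod p) (A × B × C)}
    (hu : u ∈ undetectable p A B C) : c • u ∈ undetectable p A B C := by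
  simpa [undetectable, hc] using hu

theorem natCard_dual (p : ℕ) [Fact p.Prime] (X : Type*) [AddCommGroup X] [Module (ZMod p) X]
    [Finite X] : Nat.card (Module.Dual (ZMod p) X) = Nat.card X := by
  have : Module.Finite (ZMod p) X := Module.Finite.of_finite
  exact (Nat.card_congr (Module.finBasis (ZMod p) X).toDualEquiv.toEquiv).symm

/-- With `a, b, c` the orders of `A, B, C`, there are at most `a²b²c - b²c` undetectable vectors. -/
theorem ncard_undetectable_add_le {p : ℕ} [Fact p.Prime] {A B C : Type*} [AddCommGroup A]
    [AddCommGroup B] [AddCommGroup C] [Module (ZMod p) A] [Module (ZMod p) B] [Module (ZMod p) C]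
    [Finite A] [Finite B] [Finite C] :
    (undetectable p A B C).ncard + Nat.card B ^ 2 * Nat.card C ≤
      Nat.card A ^ 2 * Nat.card B ^ 2 * Nat.card C := by
  have : Finite (Module.Dual (ZMod p) (A × B × C)) := Finite.of_injective _ DFunLike.coe_injective
  have : Finite (Module.Dual (ZMod p) (B × C)) := Finite.of_injective _ DFunLike.coe_injective
  -- `i₁` parametrises all vectors with zero `C`-shift, `a²b²c` in number; `i₂` gives `b²c` harmless
  -- ones among them, with no action on `A`.
  let i₁ : (A × B) × Module.Dual (ZMod p) (A × B × C) →
      (A × B × C) × Module.Dual (ZMod p) (A × B × C) := fun t => ((t.1.1, t.1.2, 0), t.2)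
  let i₂ : B × Module.Dual (ZMod p) (B × C) →
      (A × B × C) × Module.Dual (ZMod p) (A × B × C) :=
    fun t => ((0, t.1, 0), t.2 ∘ₗ LinearMap.snd (ZMod p) A (B × C))
  have h₁ : Function.Injective i₁ := fun s t h => by
    simp only [i₁, Prod.mk.injEq, and_true] at h
    exact Prod.ext (Prod.ext h.1.1 h.1.2) h.2
  have h₂ : Function.Injective i₂ := fun s t h => by
    simp only [i₂, Prod.mk.injEq, and_true, true_and] at h
    refine Prod.ext h.1 (LinearMap.ext fun y => ?_)
    simpa using LinearMap.congr_fun h.2 (0, y)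
  have hdisj : Disjoint (undetectable p A B C) (Set.range i₂) := by
    rw [Set.disjoint_right]
    rintro _ ⟨t, rfl⟩ ht
    exact ht.2 ⟨rfl, fun a => t.2.map_zero⟩
  have hsub : undetectable p A B C ∪ Set.range i₂ ⊆ Set.range i₁ := by
    rintro ⟨⟨x, y, z⟩, f⟩ (h | ⟨t, ht⟩)
    · have : z = 0 := h.1
      exact ⟨((x, y), f), by simp [i₁, this]⟩
    · have : z = 0 := by simpa [i₂] using (congrArg (fun u => u.1.2.2) ht).symm
      exact ⟨((x, y), f), by simp [i₁, this]⟩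
  have h := Set.ncard_le_ncard hsub
  rw [Set.ncard_union_eq hdisj, ← Set.image_univ, ← Set.image_univ,
    Set.ncard_image_of_injective _ h₁, Set.ncard_image_of_injective _ h₂, Set.ncard_univ,
    Set.ncard_univ, Nat.card_prod, Nat.card_prod, Nat.card_prod, natCard_dual, natCard_dual,
    Nat.card_prod, Nat.card_prod, Nat.card_prod] at h
  nlinarith

/-! ### Qudit errors as Weyl operators -/

section QuditErrors

variable (p : ℕ) [Fact p.Prime] (F : Type*) [Field F] [Algebra (ZMod p) F] (n : ℕ)

/-- The pairing `(b, x) ↦ ∑ tr (bᵢ xᵢ)` on `F^n`. -/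
noncomputable def tracePairing : LinearMap.BilinForm (ZMod p) (Fin n → F) :=
  LinearMap.mk₂ (ZMod p) (fun b x => ∑ i, Algebra.trace (ZMod p) F (b i * x i))
    (by intros; simp [add_mul, Finset.sum_add_distrib]) (by intros; simp [Finset.mul_sum])
    (by intros; simp [mul_add, Finset.sum_add_distrib]) (by intros; simp [Finset.mul_sum])

variable {p F n}

theorem tracePairing_apply (b x : Fin n → F) :
    tracePairing p F n b x = ∑ i, Algebra.trace (ZMod p) F (b i * x i) := rfl

theorem tracePairing_comm (b x : Fin n → F) :
    tracePairing p F n b x = tracePairing p F n x b := by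
  simp only [tracePairing_apply, mul_comm]

/-- Coordinatewise, this is nondegeneracy of the trace form of `F` over its prime field. -/
theorem tracePairing_nondegenerate [Finite F] : (tracePairing p F n).Nondegenerate := by
  classical
  have hl : ∀ b, (∀ x, tracePairing p F n b x = 0) → b = 0 := fun b hb => by
    have : Module.Finite (ZMod p) F := Module.Finite.of_finite
    ext i
    refine (traceForm_nondegenerate (ZMod p) F).1 _ fun y => ?_
    have h := hb (Pi.single i y)
    rw [tracePairing_apply, Finset.sum_eq_single i] at h
    · simpa [Algebra.traceForm_apply] using h
    · intro j _ hj; simp [hj]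
    · simp
  exact ⟨hl, fun b hb => hl b fun x => by rw [tracePairing_comm]; exact hb x⟩

theorem QuditError.op_apply [Fintype F] [DecidableEq F] (e : QuditError p F n) (v : QuditSpace F n)
    (x : Fin n → F) :
    e.op v x = (ZMod.stdAddChar (e.c + tracePairing p F n e.b (x - e.a)) : ℂ) *
      v (x - e.a) := by
  have hentry : ∀ y, (tensorOp fun i => shiftX (e.a i) * phaseZ p (e.b i)) x y =
      if y = x - e.a then (ZMod.stdAddChar (tracePairing p F n e.b (x - e.a)) : ℂ) else 0 :=
    fun y => by
      have h1 : ∀ i, (shiftX (e.a i) * phaseZ p (e.b i)) (x i) (y i) =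
          if y i = x i - e.a i then
            (ZMod.stdAddChar (Algebra.trace (ZMod p) F (e.b i * (x i - e.a i))) : ℂ) else 0 :=
        fun i => by
          rw [phaseZ, Matrix.mul_diagonal, shiftX, Matrix.of_apply]
          by_cases h : y i = x i - e.a i
          · simp [h]
          · have : x i ≠ y i + e.a i := fun h' => h (by rw [h']; ring)
            simp [h, this]
      rw [tensorOp, Matrix.of_apply]
      simp only [h1]
      split_ifs with h
      · subst h
        have h2 := map_prod (ZMod.stdAddChar (N := p)).toMonoidHom (fun i => Multiplicative.ofAdd
          (Algebra.trace (ZMod p) F (e.b i * (x - e.a) i))) Finset.univ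
        refine Eq.trans ?_ h2.symm
        simp
      · obtain ⟨i, hi⟩ := Function.ne_iff.1 h
        exact Finset.prod_eq_zero (Finset.mem_univ i) (if_neg hi)
  rw [QuditError.op, Matrix.toLpLin_apply]
  simp [Matrix.mulVec, dotProduct, hentry, AddChar.map_add_eq_mul, Matrix.smul_apply]

variable (p) in
/-- The error `X_a Z_b` attached to a vector `(a, b)`. -/
noncomputable def weylOp [Fintype F] [DecidableEq F] (w : (Fin n → F) × (Fin n → F)) :
    QuditSpace F n →ₗ[ℂ] QuditSpace F n :=
  (⟨0, w.1, w.2⟩ : QuditError p F n).op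

theorem weylOp_apply [Fintype F] [DecidableEq F] (w : (Fin n → F) × (Fin n → F))
    (v : QuditSpace F n) (x : Fin n → F) :
    weylOp p w v x =
      (ZMod.stdAddChar (tracePairing p F n w.2 (x - w.1)) : ℂ) * v (x - w.1) := by
  rw [weylOp, QuditError.op_apply, zero_add]

theorem QuditError.op_eq_smul_weylOp [Fintype F] [DecidableEq F] (e : QuditError p F n) :
    e.op = (ZMod.stdAddChar e.c : ℂ) • weylOp p (e.a, e.b) := by
  ext v x
  simp [QuditError.op_apply, weylOp_apply, AddChar.map_add_eq_mul, mul_assoc]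

theorem norm_weylOp [Fintype F] [DecidableEq F] (w : (Fin n → F) × (Fin n → F))
    (v : QuditSpace F n) : ‖weylOp p w v‖ = ‖v‖ := by
  rw [EuclideanSpace.norm_eq, EuclideanSpace.norm_eq]
  congr 1
  simp only [weylOp_apply, norm_mul, AddChar.norm_apply, one_mul]
  exact (Equiv.subRight w.1).sum_comp fun x => ‖v x‖ ^ 2

/-- Moving `Z_b` past `X_a'` costs the phase `tr (b a')`. Comparing both orders gives the
trace-symplectic form as commutator phase. -/
theorem weylOp_weylOp [Fintype F] [DecidableEq F] (w w' : (Fin n → F) × (Fin n → F))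
    (v : QuditSpace F n) : weylOp p w (weylOp p w' v) =
      (ZMod.stdAddChar (tracePairing p F n w.2 w'.1) : ℂ) • weylOp p (w + w') v := by
  ext x
  simp only [weylOp_apply, PiLp.smul_apply, smul_eq_mul, Prod.fst_add, Prod.snd_add, map_sub,
    map_add, LinearMap.add_apply, ← mul_assoc, ← AddChar.map_add_eq_mul, sub_sub]
  congr 2
  ring_nf

/-- The symplectic space `F^n × F^n` is isomorphic to `X × Dual X`. -/
theorem exists_linearEquiv_sympForm [Finite F] {X : Type*} [AddCommGroup X] [Module (ZMod p) X]
    (L : (Fin n → F) ≃ₗ[ZMod p] X) :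
    ∃ g : ((Fin n → F) × (Fin n → F)) ≃ₗ[ZMod p] X × Module.Dual (ZMod p) X,
      ∀ w w', sympForm (ZMod p) X (g w) (g w') =
        tracePairing p F n w.2 w'.1 - tracePairing p F n w'.2 w.1 := by
  refine ⟨L.prodCongr (((tracePairing p F n).toDual tracePairing_nondegenerate).trans
    L.symm.dualMap), fun w w' => ?_⟩
  simp [LinearMap.BilinForm.toDual_def]

end QuditErrors

/-! ### The Gilbert-Varshamov argument -/

/-- Gilbert-Varshamov existence of subsystem codes, as a condition on cardinalities. -/
theorem existsSubsystemCode_of_card_lt {p : ℕ} [Fact p.Prime] {F : Type*} [Field F] [Fintype F]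
    [DecidableEq F] [Algebra (ZMod p) F] {n k r c d : ℕ}
    (hcard : Fintype.card F ^ n = p ^ (k + r + c))
    (h : (∑ j ∈ Finset.Icc 1 (d - 1), n.choose j * (Fintype.card F ^ 2 - 1) ^ j) *
      (p ^ (2 * k + 2 * r + c) - p ^ (2 * r + c)) < (p - 1) * (Fintype.card F ^ (2 * n) - 1)) :
    ExistsSubsystemCode p F n (p ^ k) (p ^ r) d := by
  classical
  let A := Fin k → ZMod p
  let B := Fin r → ZMod p
  let C := Fin c → ZMod p
  let X := A × B × C
  have : Finite (Module.Dual (ZMod p) X) := Finite.of_injective _ DFunLike.coe_injective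
  let := Fintype.ofFinite (X × Module.Dual (ZMod p) X)
  have hX : Nat.card X = p ^ (k + r + c) := by
    simp [X, A, B, C, pow_add, mul_assoc]
  obtain ⟨L⟩ : Nonempty ((Fin n → F) ≃ₗ[ZMod p] X) := by
    have : Module.Finite (ZMod p) (Fin n → F) := Module.Finite.of_finite
    refine FiniteDimensional.nonempty_linearEquiv_of_finrank_eq (R := ZMod p)
      (Nat.pow_right_injective (Fact.out : p.Prime).two_le ?_)
    have h1 := Module.natCard_eq_pow_finrank (K := ZMod p) (V := Fin n → F)
    have h2 := Module.natCard_eq_pow_finrank (K := ZMod p) (V := X)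
    rw [Nat.card_zmod] at h1 h2
    simp only
    rw [← h1, ← h2, hX, ← hcard]
    simp
  obtain ⟨g₀, hg₀⟩ := exists_linearEquiv_sympForm L
  let S : Finset (X × Module.Dual (ZMod p) X) :=
    Finset.univ.filter fun u => u ∈ undetectable p A B C
  let T : Finset (X × Module.Dual (ZMod p) X) := Finset.univ.filter fun u => u ≠ 0 ∧
    (⟨0, (g₀.symm u).1, (g₀.symm u).2⟩ : QuditError p F n).weight < d
  have hSc : S.card ≤ p ^ (2 * k + 2 * r + c) - p ^ (2 * r + c) := by
    have h1 := ncard_undetectable_add_le (p := p) (A := A) (B := B) (C := C)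
    have h2 : (undetectable p A B C).ncard = S.card := by
      rw [← Set.ncard_coe_finset]; congr 1; ext; simp [S]
    simp only [A, B, C, Nat.card_eq_fintype_card, Fintype.card_pi_const, ZMod.card] at h1 h2
    rw [h2, ← pow_mul, ← pow_mul, ← pow_add, ← pow_add, ← pow_add, mul_comm r, mul_comm k] at h1
    exact Nat.le_sub_of_add_le h1
  have hTc : T.card ≤ ∑ j ∈ Finset.Icc 1 (d - 1), n.choose j * (Fintype.card F ^ 2 - 1) ^ j := by
    have := card_weight_le (M := F × F) n d
    rw [Fintype.card_prod, ← sq] at this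
    refine le_trans (Finset.card_le_card_of_injOn
      (fun u i => ((g₀.symm u).1 i, (g₀.symm u).2 i)) (fun u hu => ?_) ?_) this
    · obtain ⟨hu0, hud⟩ := (Finset.mem_filter.1 hu).2
      refine Finset.mem_coe.2 (Finset.mem_filter.2 ⟨Finset.mem_univ _, fun h0 => hu0 ?_, hud⟩)
      refine g₀.symm.map_eq_zero_iff.1 (Prod.ext ?_ ?_)
      · ext i; exact congrArg Prod.fst (congrFun h0 i)
      · ext i; exact congrArg Prod.snd (congrFun h0 i)
    · intro u _ u' _ huu
      refine g₀.symm.injective (Prod.ext ?_ ?_)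
      · ext i; exact congrArg Prod.fst (congrFun huu i)
      · ext i; exact congrArg Prod.snd (congrFun huu i)
  obtain ⟨g, hg⟩ := exists_isometry_forall_notMem (S := S) (T := T)
    (by simpa [S] using zero_notMem_undetectable p A B C) (by simp [T])
    (fun a ha u hu => by simpa [S] using smul_mem_undetectable ha (by simpa [S] using hu))
    (fun a ha u hu => by simpa [T, QuditError.weight, ha] using hu)
    (by
      refine lt_of_le_of_lt (Nat.mul_le_mul hTc hSc) (h.trans_eq ?_)
      rw [← Nat.card_eq_fintype_card (α := X × _), Nat.card_prod, natCard_dual, hX,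
        ← hcard, ← pow_add, two_mul])
  -- `G` preserves the symplectic forms, so the Weyl operators relabelled by `G.symm` obey the
  -- commutation relations on `X × Dual X`.
  let G : ((Fin n → F) × (Fin n → F)) ≃ₗ[ZMod p] X × Module.Dual (ZMod p) X := g₀.trans g.1
  have hG : ∀ u v, sympForm (ZMod p) X u v = tracePairing p F n (G.symm u).2 (G.symm v).1 -
      tracePairing p F n (G.symm v).2 (G.symm u).1 := fun u v => by
    have h1 : sympForm (ZMod p) X (g.1 (g₀ (G.symm u))) (g.1 (g₀ (G.symm v))) =
      sympForm (ZMod p) X (g₀ (G.symm u)) (g₀ (G.symm v)) := g.2 _ _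
    have h2 : ∀ u, g.1 (g₀ (G.symm u)) = u := G.apply_symm_apply
    rw [← hg₀, ← h1, h2, h2]
  obtain ⟨e, he, c', hc'⟩ := exists_orthonormal_shift_phase
    (fun u => weylOp p (G.symm u)) (fun u v => norm_weylOp _ v)
    (fun u v => ZMod.stdAddChar (tracePairing p F n (G.symm u).2 (G.symm v).1))
    (fun u v w => by rw [weylOp_weylOp, map_add])
    (fun u v w => by
      rw [weylOp_weylOp, weylOp_weylOp, smul_smul, ← AddChar.map_add_eq_mul, hG, sub_add_cancel,
        add_comm (G.symm u)])
  obtain ⟨Q, hQ⟩ := exists_subsystemCode_of_shift_phase (p := p) (K := p ^ k) (R := p ^ r)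
    (by simp [A]) (by simp [B]) he
  refine ⟨Q, fun E hE => hQ _ (G (E.a, E.b)).1 (G (E.a, E.b)).2
    (ZMod.stdAddChar E.c * c' (G (E.a, E.b))) (fun y => ?_) fun hmem => ?_⟩
  · have := hc' (G (E.a, E.b)).1 (G (E.a, E.b)).2 y
    simp only [Prod.mk.eta, LinearEquiv.symm_apply_apply] at this
    rw [QuditError.op_eq_smul_weylOp, LinearMap.smul_apply, this, smul_smul, mul_assoc]
  · have hmem' : G (E.a, E.b) ∈ undetectable p A B C := hmem
    -- An undetected `E` would give a vector of `T`, nonzero since `0` is not undetectable, that `g`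
    -- sends into `S`.
    refine hg (g₀ (E.a, E.b)) (Finset.mem_filter.2 ⟨Finset.mem_univ _, fun h0 => ?_, ?_⟩)
      (Finset.mem_filter.2 ⟨Finset.mem_univ _, hmem'⟩)
    · have : G (E.a, E.b) = 0 := by
        change g.1 (g₀ (E.a, E.b)) = 0
        rw [h0, map_zero]
      exact zero_notMem_undetectable p A B C (this ▸ hmem')
    · simpa [QuditError.weight] using hE

theorem mainTheorem5 (p : ℕ) [Fact p.Prime] (F : Type*) [Field F] [Fintype F] [DecidableEq F]
    [Algebra (ZMod p) F] (q : ℕ) (hq : Fintype.card F = q) (n K R d : ℕ)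
    (hK : ∃ k : ℕ, K = p ^ k) (hR : ∃ r : ℕ, R = p ^ r)
    (hKR : 1 < K * R) (hKRq : K * R ≤ q ^ n) (hd : 0 < d)
    (h : ∑ j ∈ Finset.Icc 1 (d - 1), (n.choose j : ℝ) * ((q : ℝ) ^ 2 - 1) ^ j *
        ((q : ℝ) ^ n * K * R - (q : ℝ) ^ n * R / K) <
      ((p : ℝ) - 1) * ((q : ℝ) ^ (2 * n) - 1)) :
    ExistsSubsystemCode p F n K R d := by
  obtain ⟨k, rfl⟩ := hK
  obtain ⟨r, rfl⟩ := hR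
  have hp : p.Prime := Fact.out
  have hq1 : 1 ≤ q := hq ▸ Fintype.card_pos
  have hqp : q ^ n = p ^ (Module.finrank (ZMod p) F * n) := by
    have := Module.card_eq_pow_finrank (K := ZMod p) (V := F)
    rw [ZMod.card, hq] at this
    rw [this, pow_mul]
  rw [hqp, ← pow_add, Nat.pow_le_pow_iff_right hp.one_lt] at hKRq
  -- `KR ≤ q^n` leaves `c` dimensions over `𝔽_p`, the coordinates set to `0` on the code.
  obtain ⟨c, hc⟩ := Nat.exists_eq_add_of_le hKRq
  rw [hc] at hqp
  refine existsSubsystemCode_of_card_lt (c := c) (by rw [hq, hqp]) ?_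
  have hp0 : (p : ℝ) ≠ 0 := Nat.cast_ne_zero.2 hp.ne_zero
  have hqR : (q : ℝ) ^ n = (p : ℝ) ^ (k + r + c) := by exact_mod_cast hqp
  have hval : (q : ℝ) ^ n * (p ^ k : ℕ) * (p ^ r : ℕ) - (q : ℝ) ^ n * (p ^ r : ℕ) / (p ^ k : ℕ) =
      (p : ℝ) ^ (2 * k + 2 * r + c) - (p : ℝ) ^ (2 * r + c) := by
    rw [hqR]
    push_cast
    field_simp
    ring
  rw [← Finset.sum_mul, hval] at h
  rw [hq]
  -- These bounds ensure that no natural-number subtraction truncates, so the real inequality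
  -- transfers.
  have hle : p ^ (2 * r + c) ≤ p ^ (2 * k + 2 * r + c) :=
    Nat.pow_le_pow_right hp.pos (by omega)
  have h1 : 1 ≤ q ^ 2 := Nat.one_le_pow _ _ hq1
  have h2 : 1 ≤ q ^ (2 * n) := Nat.one_le_pow _ _ hq1
  rw [← Nat.cast_lt (α := ℝ)]
  push_cast [Nat.cast_sub hle, Nat.cast_sub h1, Nat.cast_sub h2, Nat.cast_sub hp.one_le]
  exact h
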